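/- Let $1\le M\le N$, let $i\in\{1,\dots,M\}$ be a cluster of $K$ users with $N$ antennas each, served by a base station with $M$ antennas that uses the identity matrix as precoder. The $N\times M$ channel matrices $H_1,\dots,H_K$ of the users are Rayleigh fading: all their entries are independent with law $\mathcal{CN}(0,1)$. Write $h_{m,j}$ for the $m$-th column of $H_j$. User $j$ applies the detection vector $v_j=U_jz_j$, where $U_j$ has $N-M+1$ orthonormal columns that satisfy $U_j^Hh_{m,j}=0$ for all $m\ne i$, and $z_j=U_j^Hh_{i,j}/|U_j^Hh_{i,j}|$. Let the users be ordered by decreasing effective gain $|v_j^Hh_{i,j}|^2$, and let $x_1\ge\dots\ge x_K$ be the ordered gains, with $F_{x_k}$ the cumulative distribution function of $x_k$. The $n$-th and the $k$-th ordered users, $n<k$, with target rates $R_n,R_k>0$ and SINR thresholds $\epsilon_n=2^{R_n}-1$, $\epsilon_k=2^{R_k}-1$, are paired, with squared power coefficients $$\alpha_k^2=\min\Big\{1,\frac{\epsilon_k(x_k+1/\rho)}{x_k(1+\epsilon_k)}\Big\},\qquad \alpha_n^2=1-\alpha_k^2,$$ where $\rho>0$ is the transmit SNR. The $n$-th user is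 in outage if $\alpha_n^2=0$, or if it cannot decode the message of the $k$-th user, i.e. $\log_2(1+\mathrm{SINR}^k_n)<R_k$, or if it cannot decode its own message, i.e. $\log_2(1+\mathrm{SINR}^n_n)<R_n$; here, with $v$ and $h_m$ the detection vector and the channel columns of the $n$-th ordered user (so $x_n=|v^Hh_i|^2$) and $I_n=\sum_{m\ne i}|v^Hh_m|^2+|v|^2/\rho$, $$\mathrm{SINR}^k_n=\frac{x_n\alpha_k^2}{x_n\alpha_n^2+I_n},\qquad \mathrm{SINR}^n_n=\frac{x_n\alpha_n^2}{I_n}.$$ Let $P_n^o(\rho)$ be the probability of this event. Then for every $\rho>0$ $$P_n^o(\rho)\le F_{x_k}\Big(\frac{\epsilon_k}{\rho}+\tilde\epsilon_n\Big),\qquad \tilde\epsilon_n=\frac{(1+\epsilon_k)\epsilon_n}{\rho}.$$ Moreover $P_n^o(\rho)$ decays like $\rho^{-(N-M+1)(K-k+1)}$: it lies between two positive constant multiples of $\rho^{-(N-M+1)(K-k+1)}$ for all sufficiently large $\rho$. Hence the $n$-th user has diversity order $$\lim_{\rho\to\infty}\frac{-\log P_n^o(\rho)}{\log\rho}=(N-M+1)(K-k+1).$$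 -/

import Mathlib

open MeasureTheory ProbabilityTheory Filter Topology Asymptotics
open scoped Matrix

namespace MIMONOMA

noncomputable section

/-- The standard circularly symmetric complex Gaussian law CN(0,1): independent real and imaginary
parts, each of variance 1/2. -/
def complexGaussian : Measure ℂ :=
  ((gaussianReal 0 (1 / 2)).prod (gaussianReal 0 (1 / 2))).map
    (fun p : ℝ × ℝ => (⟨p.1, p.2⟩ : ℂ))

/-- Rayleigh fading for the `K` users of a cluster: `H j` is the random `N × M` channel matrix from
the base station to the `j`-th (unordered) user, and all the entries of all these matrices are
independent with law CN(0,1). -/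
structure IsRayleigh {Ω : Type*} [MeasurableSpace Ω] (μ : Measure Ω) {K N M : ℕ}
    (H : Fin K → Ω → Matrix (Fin N) (Fin M) ℂ) : Prop where
  hasLaw : ∀ j a b, HasLaw (fun ω => H j ω a b) complexGaussian μ
  indep : iIndepFun (fun (p : Fin K × Fin N × Fin M) (ω : Ω) => H p.1 ω p.2.1 p.2.2) μ

/-- Squared Euclidean norm of a complex vector. -/
def normSq {d : ℕ} (v : Fin d → ℂ) : ℝ := ∑ a, ‖v a‖ ^ 2

/-- The `m`-th column of the channel matrix (the precoder is the identity matrix, so this is the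
channel seen by the signal of cluster `m`). -/
def chan {N M : ℕ} (A : Matrix (Fin N) (Fin M) ℂ) (m : Fin M) : Fin N → ℂ := fun a => A a m

/-- The columns of `U` are `N - M + 1` orthonormal left singular vectors, with singular value zero,
of the `N × (M - 1)` matrix obtained from `A` by deleting its `i`-th column. (They span the whole
left null space when that matrix has rank `M - 1`, which is almost surely the case.) -/
def IsNullBasis {N M : ℕ} (i : Fin M) (A : Matrix (Fin N) (Fin M) ℂ)
    (U : Matrix (Fin N) (Fin (N - M + 1)) ℂ) : Prop :=
  Uᴴ * U = 1 ∧ ∀ m, m ≠ i → Uᴴ *ᵥ chan A m = 0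

/-- The maximal ratio combining weights `z = Uᴴ h / |Uᴴ h|`, `h` being the `i`-th column. -/
def mrcWeight {N M : ℕ} (i : Fin M) (A : Matrix (Fin N) (Fin M) ℂ)
    (U : Matrix (Fin N) (Fin (N - M + 1)) ℂ) : Fin (N - M + 1) → ℂ :=
  ((Real.sqrt (normSq (Uᴴ *ᵥ chan A i)) : ℝ) : ℂ)⁻¹ • (Uᴴ *ᵥ chan A i)

/-- The detection vector `v = U z`. -/
def detector {N M : ℕ} (i : Fin M) (A : Matrix (Fin N) (Fin M) ℂ)
    (U : Matrix (Fin N) (Fin (N - M + 1)) ℂ) : Fin N → ℂ :=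
  U *ᵥ mrcWeight i A U

/-- The power gain `|vᴴ h_m|²` after detection of the signal of cluster `m`, at a user of
cluster `i`. -/
def rxGain {N M : ℕ} (i : Fin M) (A : Matrix (Fin N) (Fin M) ℂ)
    (U : Matrix (Fin N) (Fin (N - M + 1)) ℂ) (m : Fin M) : ℝ :=
  ‖star (detector i A U) ⬝ᵥ chan A m‖ ^ 2

/-- The effective channel gain `|vᴴ h_i|²` of a user of cluster `i`. -/
def effGain {N M : ℕ} (i : Fin M) (A : Matrix (Fin N) (Fin M) ℂ)
    (U : Matrix (Fin N) (Fin (N - M + 1)) ℂ) : ℝ :=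
  rxGain i A U i

/-- Inter-cluster interference plus noise, `∑_{m ≠ i} |vᴴ h_m|² + |v|² / ρ`. -/
def interfNoise {N M : ℕ} (i : Fin M) (A : Matrix (Fin N) (Fin M) ℂ)
    (U : Matrix (Fin N) (Fin (N - M + 1)) ℂ) (ρ : ℝ) : ℝ :=
  ∑ m ∈ Finset.univ.erase i, rxGain i A U m + normSq (detector i A U) * (1 / ρ)

/-- The permutation that lists the users by decreasing effective channel gain. -/
def userOrder {K N M : ℕ} (i : Fin M) (A : Fin K → Matrix (Fin N) (Fin M) ℂ)
    (U : Fin K → Matrix (Fin N) (Fin (N - M + 1)) ℂ) : Equiv.Perm (Fin K) :=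
  Tuple.sort (fun j => -effGain i (A j) (U j))

/-- The ordered gains `x_1 ≥ ⋯ ≥ x_K`. The index is zero-based: `orderedGain i A U k` is the gain
usually called `x_{k+1}`. -/
def orderedGain {K N M : ℕ} (i : Fin M) (A : Fin K → Matrix (Fin N) (Fin M) ℂ)
    (U : Fin K → Matrix (Fin N) (Fin (N - M + 1)) ℂ) (k : Fin K) : ℝ :=
  effGain i (A (userOrder i A U k)) (U (userOrder i A U k))

/-- The SINR threshold `2 ^ R - 1` of a target rate `R`. -/
def threshold (R : ℝ) : ℝ := (2 : ℝ) ^ R - 1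

/-- The squared power coefficient given to the weaker user, whose effective gain is `x` and whose
SINR target is `ε`. (The value at `x = 0` is immaterial, as this has probability zero.) -/
def weakPower (ρ ε x : ℝ) : ℝ := min 1 (ε * (x + 1 / ρ) / (x * (1 + ε)))

/-- SINR with which a user of cluster `i` detects the message of the weaker user, of power `aw`,
the message of the stronger user, of power `as`, being treated as noise. -/
def sinrWeakMsg {N M : ℕ} (i : Fin M) (A : Matrix (Fin N) (Fin M) ℂ)
    (U : Matrix (Fin N) (Fin (N - M + 1)) ℂ) (ρ aw as : ℝ) : ℝ :=
  effGain i A U * aw / (effGain i A U * as + interfNoise i A U ρ)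

/-- SINR with which a user of cluster `i` detects the message of the stronger user, of power `as`,
after the removal of the message of the weaker user. -/
def sinrStrongMsg {N M : ℕ} (i : Fin M) (A : Matrix (Fin N) (Fin M) ℂ)
    (U : Matrix (Fin N) (Fin (N - M + 1)) ℂ) (ρ as : ℝ) : ℝ :=
  effGain i A U * as / interfNoise i A U ρ

/-- Outage at the `n`-th ordered user, paired with the `k`-th ordered user: no power is left for
it, or it cannot decode the message of the `k`-th user (target rate `Rk`), or it cannot decode its
own message (target rate `Rn`). -/
def StrongOutage {K N M : ℕ} (i : Fin M) (A : Fin K → Matrix (Fin N) (Fin M) ℂ)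
    (U : Fin K → Matrix (Fin N) (Fin (N - M + 1)) ℂ) (n k : Fin K) (Rn Rk ρ : ℝ) : Prop :=
  let aw := weakPower ρ (threshold Rk) (orderedGain i A U k)
  let as := 1 - aw
  let An := A (userOrder i A U n)
  let Un := U (userOrder i A U n)
  as = 0 ∨
    Real.logb 2 (1 + sinrWeakMsg i An Un ρ aw as) < Rk ∨
    Real.logb 2 (1 + sinrStrongMsg i An Un ρ as) < Rn

/-- The outage probability of the `n`-th ordered user of cluster `i` at transmit SNR `ρ`. -/
def outageProb {Ω : Type*} [MeasurableSpace Ω] (μ : Measure Ω) {K N M : ℕ} (i : Fin M)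
    (H : Fin K → Ω → Matrix (Fin N) (Fin M) ℂ)
    (U : Fin K → Ω → Matrix (Fin N) (Fin (N - M + 1)) ℂ) (n k : Fin K) (Rn Rk ρ : ℝ) : ℝ :=
  μ.real {ω | StrongOutage i (fun j => H j ω) (fun j => U j ω) n k Rn Rk ρ}

/-- The cumulative distribution function of the `k`-th ordered gain. -/
def orderedGainCDF {Ω : Type*} [MeasurableSpace Ω] (μ : Measure Ω) {K N M : ℕ} (i : Fin M)
    (H : Fin K → Ω → Matrix (Fin N) (Fin M) ℂ)
    (U : Fin K → Ω → Matrix (Fin N) (Fin (N - M + 1)) ℂ) (k : Fin K) (t : ℝ) : ℝ :=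
  μ.real {ω | orderedGain i (fun j => H j ω) (fun j => U j ω) k ≤ t}

/-- The outage probability `P`, as a function of the SNR, has diversity order `d`. -/
def HasDiversityOrder (P : ℝ → ℝ) (d : ℝ) : Prop :=
  Tendsto (fun ρ => -Real.log (P ρ) / Real.log ρ) atTop (𝓝 d)

end

end MIMONOMA

namespace MIMONOMA

/-! Zero forcing removes the interference, so the outage event is governed by the ordered gain `x`
of the weaker user alone. The allocation leaves the stronger user no power when `0 < x ≤ ε_k / ρ`.
Otherwise the weaker user gets just enough, and the stronger one, whose gain is at least `x`, can
fail only if `x ≤ ε_k / ρ + (1 + ε_k) ε_n / ρ`. Outage thus lies, almost surely, between two events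
`x ≤ const / ρ`.

It remains to estimate the law of `x` near zero. The gain of a user is `|Uᴴ h_i|²`, which for
independent columns is the squared distance (`residual`) from `h_i` to the span of the other
columns, whatever the choice of `U`. Given those columns, unitary invariance makes `Uᴴ h_i` a
standard Gaussian vector of dimension `N - M + 1`, so the gain is at most `t` with probability of
order `t ^ (N - M + 1)`. The ordered gain is small iff some `K - k` of the independent users (`k`
zero-based) have small gains, which multiplies the exponent by `K - k`. -/

/-! ### Squared norms and orthonormal columns. -/

lemma normSq_nonneg {d : ℕ} (v : Fin d → ℂ) : 0 ≤ normSq v :=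
  Finset.sum_nonneg fun _ _ => sq_nonneg _

lemma normSq_eq_zero {d : ℕ} {v : Fin d → ℂ} : normSq v = 0 ↔ v = 0 := by
  rw [normSq, Finset.sum_eq_zero_iff_of_nonneg fun _ _ => sq_nonneg _]
  simp [funext_iff]

lemma ofReal_normSq {d : ℕ} (v : Fin d → ℂ) : (normSq v : ℂ) = star v ⬝ᵥ v := by
  simp only [normSq, dotProduct, Pi.star_apply, Complex.ofReal_sum]
  refine Finset.sum_congr rfl fun a _ => ?_
  rw [RCLike.star_def, Complex.conj_mul', Complex.ofReal_pow]

lemma normSq_smul {d : ℕ} (c : ℂ) (v : Fin d → ℂ) : normSq (c • v) = ‖c‖ ^ 2 * normSq v := by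
  simp [normSq, mul_pow, Finset.mul_sum]

lemma continuous_normSq {d : ℕ} : Continuous (normSq : (Fin d → ℂ) → ℝ) := by
  unfold normSq; fun_prop

lemma star_conjTranspose_mulVec_dotProduct {N d : ℕ} (U : Matrix (Fin N) (Fin d) ℂ)
    (x : Fin N → ℂ) (y : Fin d → ℂ) : star (Uᴴ *ᵥ x) ⬝ᵥ y = star x ⬝ᵥ (U *ᵥ y) := by
  rw [Matrix.star_mulVec, Matrix.conjTranspose_conjTranspose, Matrix.dotProduct_mulVec]

lemma normSq_mulVec_of_orthonormal {N d : ℕ} {U : Matrix (Fin N) (Fin d) ℂ} (hU : Uᴴ * U = 1)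
    (y : Fin d → ℂ) : normSq (U *ᵥ y) = normSq y := by
  have h : (normSq (U *ᵥ y) : ℂ) = normSq y := by
    rw [ofReal_normSq, ← star_conjTranspose_mulVec_dotProduct, Matrix.mulVec_mulVec, hU,
      Matrix.one_mulVec, ofReal_normSq]
  exact_mod_cast h

/-! ### Complex Gaussian vectors and unitary invariance. -/

instance : IsProbabilityMeasure complexGaussian := by
  unfold complexGaussian
  exact Measure.isProbabilityMeasure_map
    (Complex.measurableEquivRealProd.symm.measurable.aemeasurable)

lemma complexGaussian_eq_map : complexGaussian =
    ((gaussianReal 0 (1 / 2)).prod (gaussianReal 0 (1 / 2))).map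
      Complex.measurableEquivRealProd.symm := rfl

lemma charFun_complexGaussian (t : ℂ) :
    charFun complexGaussian t = Complex.exp (-((‖t‖ ^ 2 : ℝ) : ℂ) / 4) := by
  rw [charFun_apply, complexGaussian_eq_map, integral_map_equiv]
  have h : ∀ p : ℝ × ℝ, Complex.exp ((inner ℝ (Complex.measurableEquivRealProd.symm p) t : ℝ) *
      Complex.I) = Complex.exp (t.re * p.1 * Complex.I) * Complex.exp (t.im * p.2 * Complex.I) := by
    intro p
    rw [← Complex.exp_add]
    congr 1
    simp [Complex.inner, Complex.measurableEquivRealProd_symm_apply]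
    ring
  simp_rw [h]
  rw [integral_prod_mul (fun x : ℝ => Complex.exp (t.re * x * Complex.I))
    (fun x : ℝ => Complex.exp (t.im * x * Complex.I)), ← charFun_apply_real, ← charFun_apply_real,
    charFun_gaussianReal, charFun_gaussianReal, ← Complex.exp_add]
  congr 1
  rw [← Complex.normSq_eq_norm_sq, Complex.normSq_apply]
  push_cast
  ring

/-- Unitary invariance of the standard complex Gaussian vector: its coordinates along an
orthonormal family are again independent CN(0,1). -/
lemma map_conjTranspose_mulVec_pi_complexGaussian {N d : ℕ} {U : Matrix (Fin N) (Fin d) ℂ}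
    (hU : Uᴴ * U = 1) :
    (Measure.pi fun _ : Fin N => complexGaussian).map (fun h => Uᴴ *ᵥ h) =
      Measure.pi fun _ : Fin d => complexGaussian := by
  have hm : Measurable fun h : Fin N → ℂ => Uᴴ *ᵥ h := by fun_prop
  have : IsProbabilityMeasure ((Measure.pi fun _ : Fin N => complexGaussian).map
    (fun h => Uᴴ *ᵥ h)) := Measure.isProbabilityMeasure_map hm.aemeasurable
  rw [← charFun_eq_pi_iff]
  intro t
  rw [charFun_apply, integral_map (by fun_prop) (by fun_prop), integral_map (by fun_prop)
    (by fun_prop)]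
  have h1 : ∀ (n : ℕ) (x y : EuclideanSpace ℂ (Fin n)),
      inner ℝ x y = (star x.ofLp ⬝ᵥ y.ofLp).re := by
    intro n x y
    simp only [PiLp.inner_apply, dotProduct, Complex.re_sum, Complex.inner]
    refine Finset.sum_congr rfl fun a _ => ?_
    rw [mul_comm]
    rfl
  -- By adjunction, the image law at `t` has the characteristic function of the source at `U *ᵥ t`.
  -- That function depends only on the norm of its argument, which `U` preserves.
  have h2 := charFun_pi (μ := fun _ : Fin N => complexGaussian)
    (WithLp.toLp 2 (U *ᵥ t.ofLp) : EuclideanSpace ℂ (Fin N))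
  rw [charFun_apply, integral_map (by fun_prop) (by fun_prop)] at h2
  simp only [h1, star_conjTranspose_mulVec_dotProduct] at h2 ⊢
  rw [h2]
  simp only [charFun_complexGaussian, ← Complex.exp_sum, ← Finset.sum_div, Finset.sum_neg_distrib,
    ← Complex.ofReal_sum]
  have := normSq_mulVec_of_orthonormal hU t.ofLp
  unfold normSq at this
  rw [this]

/-! ### Small-ball probabilities. -/

/-- With variance `1/2` the density is `a * exp (-x²)`, which lies between `a * exp (-1)` and `a` on
`[-1, 1]`. -/
lemma gaussianReal_Icc_bounds : ∃ c C : ℝ, 0 < c ∧ 0 < C ∧ ∀ s : ℝ, 0 ≤ s → s ≤ 1 →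
    c * s ≤ (gaussianReal 0 (1 / 2)).real (Set.Icc (-s) s) ∧
      (gaussianReal 0 (1 / 2)).real (Set.Icc (-s) s) ≤ C * s := by
  set a : ℝ := (√(2 * Real.pi * ((1 / 2 : NNReal) : ℝ)))⁻¹ with ha
  have ha0 : 0 < a := by positivity
  refine ⟨2 * (a * Real.exp (-1)), 2 * a, by positivity, by positivity, fun s hs0 hs1 => ?_⟩
  have hv : (1 / 2 : NNReal) ≠ 0 := by norm_num
  have hI : (gaussianReal 0 (1 / 2)).real (Set.Icc (-s) s) =
      ∫ x in Set.Icc (-s) s, gaussianPDFReal 0 (1 / 2) x := by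
    rw [Measure.real, gaussianReal_apply_eq_integral _ hv, ENNReal.toReal_ofReal]
    exact integral_nonneg fun x => gaussianPDFReal_nonneg _ _ _
  have hint : IntegrableOn (gaussianPDFReal 0 (1 / 2)) (Set.Icc (-s) s) :=
    (integrable_gaussianPDFReal _ _).integrableOn
  have hexp : ∀ x : ℝ, -(x - 0) ^ 2 / (2 * ((1 / 2 : NNReal) : ℝ)) = -x ^ 2 := by
    intro x
    push_cast
    ring
  have hconst : ∀ b : ℝ, ∫ _ in Set.Icc (-s) s, b = 2 * b * s := by
    intro b
    rw [setIntegral_const, Real.volume_real_Icc_of_le (by linarith), smul_eq_mul]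
    ring
  rw [hI]
  constructor
  · rw [mul_assoc, ← mul_assoc 2, ← hconst]
    refine setIntegral_mono_on continuousOn_const.integrableOn_Icc hint measurableSet_Icc fun x hx => ?_
    rw [gaussianPDFReal, hexp]
    refine mul_le_mul_of_nonneg_left (Real.exp_le_exp.2 ?_) ha0.le
    have : x ^ 2 ≤ 1 := by
      rw [sq_le_one_iff_abs_le_one]
      exact (abs_le.2 hx).trans hs1
    linarith
  · rw [← hconst]
    refine setIntegral_mono_on hint continuousOn_const.integrableOn_Icc measurableSet_Icc fun x hx => ?_
    rw [gaussianPDFReal, hexp]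
    refine mul_le_of_le_one_right ha0.le (Real.exp_le_one_iff.2 ?_)
    exact neg_nonpos.2 (sq_nonneg x)

/-- The disc of radius `√t` lies between the squares of half-sides `√(t / 2)` and `√t`. -/
lemma complexGaussian_smallBall : ∃ c C : ℝ, 0 < c ∧ 0 < C ∧ ∀ t : ℝ, 0 ≤ t → t ≤ 1 →
    c * t ≤ complexGaussian.real {z | ‖z‖ ^ 2 ≤ t} ∧
      complexGaussian.real {z | ‖z‖ ^ 2 ≤ t} ≤ C * t := by
  obtain ⟨c, C, hc, hC, h⟩ := gaussianReal_Icc_bounds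
  refine ⟨c ^ 2 / 2, C ^ 2, by positivity, by positivity, fun t ht0 ht1 => ?_⟩
  set γ := gaussianReal 0 (1 / 2)
  have hmap : complexGaussian.real {z | ‖z‖ ^ 2 ≤ t} =
      (γ.prod γ).real {p | p.1 ^ 2 + p.2 ^ 2 ≤ t} := by
    rw [complexGaussian_eq_map, map_measureReal_apply
      Complex.measurableEquivRealProd.symm.measurable
      (measurableSet_le (by fun_prop) measurable_const)]
    congr 1
    ext p
    rw [Set.mem_preimage, Set.mem_ofPred_eq, Set.mem_ofPred_eq, ← Complex.normSq_eq_norm_sq,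
      Complex.normSq_apply, sq, sq, Complex.measurableEquivRealProd_symm_apply]
  rw [hmap]
  constructor
  · have hs := (h (√(t / 2)) (Real.sqrt_nonneg _) (Real.sqrt_le_one.2 (by linarith))).1
    calc c ^ 2 / 2 * t = (c * √(t / 2)) * (c * √(t / 2)) := by
          rw [mul_mul_mul_comm, Real.mul_self_sqrt (by positivity)]; ring
      _ ≤ _ := mul_le_mul hs hs (by positivity) (by positivity)
      _ = (γ.prod γ).real (Set.Icc (-√(t / 2)) √(t / 2) ×ˢ Set.Icc (-√(t / 2)) √(t / 2)) :=
          (measureReal_prod_prod _ _).symm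
      _ ≤ _ := by
          refine measureReal_mono ?_
          rintro ⟨x, y⟩ ⟨hx, hy⟩
          have h1 := Real.sq_le (by positivity) |>.2 (abs_le.2 hx |> abs_le.1)
          have h2 := Real.sq_le (by positivity) |>.2 (abs_le.2 hy |> abs_le.1)
          simp only [Set.mem_ofPred_eq] at *
          linarith
  · have hs := (h (√t) (Real.sqrt_nonneg _) (Real.sqrt_le_one.2 ht1)).2
    calc (γ.prod γ).real {p | p.1 ^ 2 + p.2 ^ 2 ≤ t}
        ≤ (γ.prod γ).real (Set.Icc (-√t) √t ×ˢ Set.Icc (-√t) √t) := by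
          refine measureReal_mono ?_
          rintro ⟨x, y⟩ hxy
          simp only [Set.mem_ofPred_eq] at hxy
          exact ⟨(Real.sq_le ht0).1 (by nlinarith [sq_nonneg y]),
            (Real.sq_le ht0).1 (by nlinarith [sq_nonneg x])⟩
      _ = _ := measureReal_prod_prod _ _
      _ ≤ (C * √t) * (C * √t) := mul_le_mul hs hs (by positivity) (by positivity)
      _ = C ^ 2 * t := by rw [mul_mul_mul_comm, Real.mul_self_sqrt ht0]; ring

lemma pi_complexGaussian_smallBall (d : ℕ) : ∃ c C : ℝ, 0 < c ∧ 0 < C ∧ ∀ t : ℝ, 0 ≤ t → t ≤ 1 →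
    c * t ^ d ≤ (Measure.pi fun _ : Fin d => complexGaussian).real {y | normSq y ≤ t} ∧
      (Measure.pi fun _ : Fin d => complexGaussian).real {y | normSq y ≤ t} ≤ C * t ^ d := by
  obtain ⟨c, C, hc, hC, h⟩ := complexGaussian_smallBall
  -- The ball contains the polydisc `|y a|² ≤ t / (d + 1)` and lies in `|y a|² ≤ t`; `d + 1` instead
  -- of `d` covers `d = 0`.
  refine ⟨(c / (d + 1)) ^ d, C ^ d, by positivity, by positivity, fun t ht0 ht1 => ?_⟩
  have hbox : ∀ s : ℝ, (Measure.pi fun _ : Fin d => complexGaussian).real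
      (Set.univ.pi fun _ => {z | ‖z‖ ^ 2 ≤ s}) = complexGaussian.real {z | ‖z‖ ^ 2 ≤ s} ^ d := by
    intro s
    simp [Measure.real, Measure.pi_pi]
  constructor
  · have ht : t / (d + 1) ≤ 1 := div_le_one_of_le₀ (by linarith [(d.cast_nonneg : (0:ℝ) ≤ d)])
      (by positivity)
    calc (c / (d + 1)) ^ d * t ^ d = (c * (t / (d + 1))) ^ d := by rw [← mul_pow]; ring
      _ ≤ _ := pow_le_pow_left₀ (by positivity) (h _ (by positivity) ht).1 d
      _ = _ := (hbox _).symm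
      _ ≤ _ := by
        refine measureReal_mono fun y hy => ?_
        simp only [Set.mem_pi, Set.mem_univ, Set.mem_ofPred_eq, true_implies] at hy ⊢
        calc normSq y ≤ ∑ _ : Fin d, t / (d + 1) := Finset.sum_le_sum fun a _ => hy a
          _ = d * t / (d + 1) := by simp; ring
          _ ≤ t := by
            rw [div_le_iff₀ (by positivity)]
            nlinarith
  · rw [← mul_pow]
    refine le_trans (le_trans (measureReal_mono fun y hy => ?_) (hbox t).le)
      (pow_le_pow_left₀ (by positivity) (h t ht0 ht1).2 d)
    simp only [Set.mem_pi, Set.mem_univ, Set.mem_ofPred_eq, true_implies] at hy ⊢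
    exact fun a => (Finset.single_le_sum (f := fun a => ‖y a‖ ^ 2) (fun _ _ => sq_nonneg _)
      (Finset.mem_univ a)).trans hy

/-! ### Distance of a column to the span of the others. -/

/-- Squared distance of the vector `B m` to the span of the other vectors of the family `B`. -/
noncomputable def residual {N M : ℕ} (m : Fin M) (B : Fin M → Fin N → ℂ) : ℝ :=
  ⨅ c : {l // l ≠ m} → ℂ, normSq (B m - ∑ l, c l • B l)

lemma bddBelow_residual {N M : ℕ} (m : Fin M) (B : Fin M → Fin N → ℂ) :
    BddBelow (Set.range fun c : {l // l ≠ m} → ℂ => normSq (B m - ∑ l, c l • B l)) :=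
  ⟨0, by rintro _ ⟨c, rfl⟩; exact normSq_nonneg _⟩

/-- Since `U` is not assumed measurable in `ω`, the probability computations are made with this
function of the channel alone. -/
lemma measurable_residual {N M : ℕ} (m : Fin M) :
    Measurable (residual m : (Fin M → Fin N → ℂ) → ℝ) := by
  refine UpperSemicontinuous.measurable
    (upperSemicontinuous_ciInf (fun B => bddBelow_residual m B) fun c => ?_)
  refine Continuous.upperSemicontinuous ?_
  exact continuous_normSq.comp (by fun_prop)

lemma normSq_conjTranspose_mulVec_le {N d : ℕ} {U : Matrix (Fin N) (Fin d) ℂ} (hU : Uᴴ * U = 1)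
    (x : Fin N → ℂ) : normSq (Uᴴ *ᵥ x) ≤ normSq x := by
  have h : (normSq (x - U *ᵥ (Uᴴ *ᵥ x)) : ℂ) = normSq x - normSq (Uᴴ *ᵥ x) := by
    have h1 : star (U *ᵥ (Uᴴ *ᵥ x)) ⬝ᵥ x = star (Uᴴ *ᵥ x) ⬝ᵥ (Uᴴ *ᵥ x) := by
      rw [Matrix.star_mulVec, ← Matrix.dotProduct_mulVec]
    have h2 : star (U *ᵥ (Uᴴ *ᵥ x)) ⬝ᵥ (U *ᵥ (Uᴴ *ᵥ x)) = star (Uᴴ *ᵥ x) ⬝ᵥ (Uᴴ *ᵥ x) := by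
      rw [← ofReal_normSq, normSq_mulVec_of_orthonormal hU, ofReal_normSq]
    rw [ofReal_normSq, star_sub, sub_dotProduct, dotProduct_sub, dotProduct_sub, h1, h2,
      ← star_conjTranspose_mulVec_dotProduct, ofReal_normSq, ofReal_normSq]
    ring
  have h' : normSq (x - U *ᵥ (Uᴴ *ᵥ x)) = normSq x - normSq (Uᴴ *ᵥ x) := by exact_mod_cast h
  linarith [normSq_nonneg (x - U *ᵥ (Uᴴ *ᵥ x))]

/-- `Uᴴ` kills every combination of the other vectors and does not increase norms. No linear
independence is needed. -/
lemma normSq_le_residual {N M d : ℕ} {m : Fin M} {B : Fin M → Fin N → ℂ}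
    {U : Matrix (Fin N) (Fin d) ℂ} (hU : Uᴴ * U = 1) (hB : ∀ l, l ≠ m → Uᴴ *ᵥ B l = 0) :
    normSq (Uᴴ *ᵥ B m) ≤ residual m B := by
  refine le_ciInf fun c => ?_
  have h : Uᴴ *ᵥ (B m - ∑ l : {l // l ≠ m}, c l • B l) = Uᴴ *ᵥ B m := by
    rw [Matrix.mulVec_sub, Matrix.mulVec_sum, Finset.sum_eq_zero, sub_zero]
    intro l _
    rw [Matrix.mulVec_smul, hB l l.2, smul_zero]
  rw [← h]
  exact normSq_conjTranspose_mulVec_le hU _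

/-- As `(N - M + 1) + (M - 1) = N`, the columns of `U` and the other vectors form a basis. The
decomposition of `B m` in it provides coefficients that attain the infimum. -/
lemma residual_eq_normSq {N M : ℕ} (hMN : M ≤ N) {m : Fin M} {B : Fin M → Fin N → ℂ}
    (hLI : LinearIndependent ℂ B) {U : Matrix (Fin N) (Fin (N - M + 1)) ℂ} (hU : Uᴴ * U = 1)
    (hB : ∀ l, l ≠ m → Uᴴ *ᵥ B l = 0) : residual m B = normSq (Uᴴ *ᵥ B m) := by
  refine le_antisymm ?_ (normSq_le_residual hU hB)
  have hLI' : LinearIndependent ℂ fun l : {l // l ≠ m} => B l :=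
    hLI.comp _ Subtype.val_injective
  let T : (Fin (N - M + 1) → ℂ) × ({l // l ≠ m} → ℂ) →ₗ[ℂ] (Fin N → ℂ) :=
    U.mulVecLin.coprod (Fintype.linearCombination ℂ fun l : {l // l ≠ m} => B l)
  have hT : ∀ a c, T (a, c) = U *ᵥ a + ∑ l : {l // l ≠ m}, c l • B l := fun a c => by
    simp [T, Fintype.linearCombination_apply]
  have hUT : ∀ a c, Uᴴ *ᵥ T (a, c) = a := fun a c => by
    rw [hT, Matrix.mulVec_add, Matrix.mulVec_mulVec, hU, Matrix.one_mulVec, Matrix.mulVec_sum,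
      Finset.sum_eq_zero, add_zero]
    intro l _
    rw [Matrix.mulVec_smul, hB l l.2, smul_zero]
  have hinj : Function.Injective T := by
    rw [injective_iff_map_eq_zero]
    rintro ⟨a, c⟩ h
    have ha : a = 0 := by rw [← hUT a c, h, Matrix.mulVec_zero]
    subst ha
    rw [hT, Matrix.mulVec_zero, zero_add] at h
    have hc := Fintype.linearIndependent_iff.1 hLI' c h
    exact Prod.ext rfl (funext hc)
  have hdim : Module.finrank ℂ ((Fin (N - M + 1) → ℂ) × ({l // l ≠ m} → ℂ)) =
      Module.finrank ℂ (Fin N → ℂ) := by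
    have := m.pos
    simp [Fintype.card_subtype_compl]
    omega
  obtain ⟨⟨a, c⟩, hac⟩ := (LinearMap.injective_iff_surjective_of_finrank_eq_finrank hdim).1 hinj
    (B m)
  have ha : Uᴴ *ᵥ B m = a := by rw [← hac, hUT]
  rw [hT] at hac
  refine (ciInf_le (bddBelow_residual m B) c).trans ?_
  rw [← eq_sub_iff_add_eq.2 hac, normSq_mulVec_of_orthonormal hU, ha]

lemma linearIndependent_of_residual_pos {N M : ℕ} {B : Fin M → Fin N → ℂ}
    (h : ∀ m, 0 < residual m B) : LinearIndependent ℂ B := by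
  rw [Fintype.linearIndependent_iff]
  intro g hg m
  by_contra hm
  refine (h m).not_ge ((ciInf_le (bddBelow_residual m B) fun l => -(g m)⁻¹ * g l).trans ?_)
  refine (normSq_eq_zero.2 ?_).le
  rw [Fintype.sum_eq_add_sum_subtype_ne _ m] at hg
  simp only [mul_smul, neg_smul, Finset.sum_neg_distrib, sub_neg_eq_add, ← Finset.smul_sum]
  rw [eq_neg_of_add_eq_zero_right hg, smul_neg, smul_smul,
    inv_mul_cancel₀ hm, one_smul, add_neg_cancel]

lemma exists_orthonormal_null {N M : ℕ} (hMN : M ≤ N) (m : Fin M) (B : Fin M → Fin N → ℂ) :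
    ∃ U : Matrix (Fin N) (Fin (N - M + 1)) ℂ, Uᴴ * U = 1 ∧ ∀ l, l ≠ m → Uᴴ *ᵥ B l = 0 := by
  let W : Submodule ℂ (EuclideanSpace ℂ (Fin N)) :=
    Submodule.span ℂ (Set.range fun l : {l // l ≠ m} => WithLp.toLp 2 (B l))
  have hW : Module.finrank ℂ W ≤ M - 1 := by
    refine (finrank_range_le_card _).trans ?_
    simp [Fintype.card_subtype_compl]
  have hWo : N - M + 1 ≤ Module.finrank ℂ Wᗮ := by
    have := W.finrank_add_finrank_orthogonal
    rw [finrank_euclideanSpace_fin] at this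
    have := m.pos
    omega
  -- If the other vectors are dependent, `Wᗮ` has larger dimension; only `N - M + 1` of its basis
  -- vectors are kept.
  let b : Fin (N - M + 1) → EuclideanSpace ℂ (Fin N) := fun j =>
    stdOrthonormalBasis ℂ Wᗮ (Fin.castLE hWo j)
  have hb : Orthonormal ℂ b :=
    ((stdOrthonormalBasis ℂ Wᗮ).orthonormal.comp _ (Fin.castLE_injective hWo)).comp_linearIsometry
      Wᗮ.subtypeₗᵢ
  refine ⟨Matrix.of fun a j => b j a, ?_, fun l hl => ?_⟩
  · ext j j'
    rw [orthonormal_iff_ite] at hb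
    rw [Matrix.one_apply, ← hb j j', PiLp.inner_apply, Matrix.mul_apply]
    refine Finset.sum_congr rfl fun a _ => ?_
    simp [mul_comm]
  · ext j
    have h : inner ℂ (b j) (WithLp.toLp 2 (B l)) = 0 :=
      Submodule.inner_left_of_mem_orthogonal (K := W) (Submodule.subset_span ⟨⟨l, hl⟩, rfl⟩)
        (Subtype.property _)
    rw [Pi.zero_apply, ← h, PiLp.inner_apply, Matrix.mulVec, dotProduct]
    refine Finset.sum_congr rfl fun a _ => ?_
    simp [mul_comm]

/-! ### Law of the residual of a Rayleigh matrix. -/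

/-- Resampling one coordinate of a product probability measure preserves it. -/
lemma map_update_pi_prod {ι X : Type*} [Fintype ι] [DecidableEq ι] [MeasurableSpace X]
    (γ : Measure X) [IsProbabilityMeasure γ] (m : ι) :
    ((Measure.pi fun _ : ι => γ).prod γ).map (fun p => Function.update p.1 m p.2) =
      Measure.pi fun _ : ι => γ := by
  have hmeas : Measurable fun p : (ι → X) × X => Function.update p.1 m p.2 := by
    refine measurable_pi_lambda _ fun l => ?_
    rcases eq_or_ne l m with rfl | h
    · simpa using measurable_snd
    · simp only [Function.update_of_ne h]
      fun_prop
  refine (Measure.pi_eq fun s hs => ?_).symm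
  rw [Measure.map_apply hmeas (MeasurableSet.univ_pi hs)]
  have hpre : (fun p : (ι → X) × X => Function.update p.1 m p.2) ⁻¹' Set.univ.pi s =
      (Set.univ.pi (Function.update s m Set.univ)) ×ˢ s m := by
    ext ⟨B, h⟩
    simp only [Set.mem_preimage, Set.mem_pi, Set.mem_univ, true_implies, Set.mem_prod]
    constructor
    · intro hB
      refine ⟨fun l => ?_, by simpa using hB m⟩
      rcases eq_or_ne l m with rfl | hl
      · simp
      · simpa [hl] using hB l
    · rintro ⟨hB, hh⟩ l
      rcases eq_or_ne l m with rfl | hl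
      · simpa using hh
      · simpa [hl] using hB l
  rw [hpre, Measure.prod_prod, Measure.pi_pi, ← Finset.mul_prod_erase _ _ (Finset.mem_univ m),
    ← Finset.mul_prod_erase _ (fun l => γ (s l)) (Finset.mem_univ m), Function.update_self,
    measure_univ, one_mul, mul_comm]
  congr 1
  refine Finset.prod_congr rfl fun l hl => ?_
  rw [Function.update_of_ne (Finset.ne_of_mem_erase hl)]

/-- The law of the family of the `M` columns of an `N × M` Rayleigh fading matrix. -/
noncomputable def rayleighLaw (N M : ℕ) : Measure (Fin M → Fin N → ℂ) :=
  Measure.pi fun _ => Measure.pi fun _ => complexGaussian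

instance (N M : ℕ) : IsProbabilityMeasure (rayleighLaw N M) := by
  unfold rayleighLaw; infer_instance

lemma measurable_update_prod {N M : ℕ} (m : Fin M) :
    Measurable fun p : (Fin M → Fin N → ℂ) × (Fin N → ℂ) => Function.update p.1 m p.2 :=
  (continuous_fst.update m continuous_snd).measurable

/-- Conditioning on the columns other than `m`, expressed as resampling of column `m` followed by
Tonelli. -/
lemma rayleighLaw_apply {N M : ℕ} (m : Fin M) {S : Set (Fin M → Fin N → ℂ)}
    (hS : MeasurableSet S) : rayleighLaw N M S =
      ∫⁻ B, (Measure.pi fun _ => complexGaussian) {h | Function.update B m h ∈ S}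
        ∂(rayleighLaw N M) := by
  conv_lhs => rw [rayleighLaw, ← map_update_pi_prod _ m, Measure.map_apply
    (measurable_update_prod m) hS, Measure.prod_apply (measurable_update_prod m hS)]
  rfl

lemma gaussian_null_smallBall {N d : ℕ} {U : Matrix (Fin N) (Fin d) ℂ} (hU : Uᴴ * U = 1) (t : ℝ) :
    (Measure.pi fun _ : Fin N => complexGaussian) {h | normSq (Uᴴ *ᵥ h) ≤ t} =
      ENNReal.ofReal ((Measure.pi fun _ : Fin d => complexGaussian).real {y | normSq y ≤ t}) := by
  rw [Measure.real, ENNReal.ofReal_toReal (measure_ne_top _ _),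
    ← map_conjTranspose_mulVec_pi_complexGaussian hU, Measure.map_apply (by fun_prop)
    (measurableSet_le continuous_normSq.measurable measurable_const)]
  rfl

lemma measurableSet_residual_le {N M : ℕ} (m : Fin M) (t : ℝ) :
    MeasurableSet {B : Fin M → Fin N → ℂ | residual m B ≤ t} :=
  measurableSet_le (measurable_residual m) measurable_const

/-- A matrix `U` adapted to `B` stays adapted when column `m` is resampled, so it is fixed while `h`
is Gaussian. Independence of the columns is not used, so this bound can serve to prove it. -/
lemma rayleighLaw_residual_le {N M : ℕ} (hMN : M ≤ N) (m : Fin M) (t : ℝ) :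
    (rayleighLaw N M).real {B | residual m B ≤ t} ≤
      (Measure.pi fun _ : Fin (N - M + 1) => complexGaussian).real {y | normSq y ≤ t} := by
  refine ENNReal.toReal_le_of_le_ofReal measureReal_nonneg ?_
  rw [rayleighLaw_apply m (measurableSet_residual_le m t)]
  refine (lintegral_mono (g := fun _ => _) fun B => ?_).trans_eq
    (by rw [lintegral_const, measure_univ, mul_one])
  obtain ⟨U, hU, hUB⟩ := exists_orthonormal_null hMN m B
  rw [← gaussian_null_smallBall hU]
  refine measure_mono fun h hh => ?_
  have := normSq_le_residual (m := m) (B := Function.update B m h) hU fun l hl => by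
    rw [Function.update_of_ne hl, hUB l hl]
  rw [Function.update_self] at this
  exact this.trans hh

/-- The upper bound at `t = 0` vanishes because the exponent `N - M + 1` is positive. -/
lemma ae_residual_pos {N M : ℕ} (hMN : M ≤ N) :
    ∀ᵐ B ∂(rayleighLaw N M), ∀ m, 0 < residual m B := by
  rw [ae_all_iff]
  intro m
  obtain ⟨c, C, -, -, h⟩ := pi_complexGaussian_smallBall (N - M + 1)
  have h0 := (rayleighLaw_residual_le hMN m 0).trans (h 0 le_rfl zero_le_one).2
  rw [zero_pow (Nat.succ_ne_zero _), mul_zero] at h0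
  rw [ae_iff]
  simp only [not_lt]
  exact (measureReal_eq_zero_iff).1 (le_antisymm h0 measureReal_nonneg)

lemma ae_linearIndependent {N M : ℕ} (hMN : M ≤ N) :
    ∀ᵐ B ∂(rayleighLaw N M), LinearIndependent ℂ B :=
  (ae_residual_pos hMN).mono fun _ => linearIndependent_of_residual_pos

/-- Almost sure independence turns the inequality `normSq_le_residual` into an equality. -/
lemma le_rayleighLaw_residual {N M : ℕ} (hMN : M ≤ N) (m : Fin M) (t : ℝ) :
    (Measure.pi fun _ : Fin (N - M + 1) => complexGaussian).real {y | normSq y ≤ t} ≤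
      (rayleighLaw N M).real {B | residual m B ≤ t} := by
  refine (ENNReal.ofReal_le_iff_le_toReal (measure_ne_top _ _)).1 ?_
  rw [rayleighLaw_apply m (measurableSet_residual_le m t)]
  have hae : ∀ᵐ B ∂(rayleighLaw N M), ∀ᵐ h ∂(Measure.pi fun _ : Fin N => complexGaussian),
      LinearIndependent ℂ (Function.update B m h) := by
    have := ae_linearIndependent hMN
    rw [rayleighLaw, ← map_update_pi_prod _ m] at this
    exact Measure.ae_ae_of_ae_prod (ae_of_ae_map (measurable_update_prod m).aemeasurable this)
  refine Eq.trans_le (by rw [lintegral_const, measure_univ, mul_one])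
    (lintegral_mono_ae (f := fun _ => _) ?_)
  filter_upwards [hae] with B hB
  obtain ⟨U, hU, hUB⟩ := exists_orthonormal_null hMN m B
  rw [← gaussian_null_smallBall hU]
  refine measure_mono_ae ?_
  filter_upwards [hB] with h hh ht
  have := residual_eq_normSq hMN hh (m := m) hU fun l hl => by
    rw [Function.update_of_ne hl, hUB l hl]
  rw [Function.update_self] at this
  exact this.trans_le ht

lemma rayleighLaw_residual_bounds {N M : ℕ} (hMN : M ≤ N) (m : Fin M) :
    ∃ c C : ℝ, 0 < c ∧ 0 < C ∧ ∀ t : ℝ, 0 ≤ t → t ≤ 1 →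
      c * t ^ (N - M + 1) ≤ (rayleighLaw N M).real {B | residual m B ≤ t} ∧
        (rayleighLaw N M).real {B | residual m B ≤ t} ≤ C * t ^ (N - M + 1) := by
  obtain ⟨c, C, hc, hC, h⟩ := pi_complexGaussian_smallBall (N - M + 1)
  exact ⟨c, C, hc, hC, fun t h0 h1 => ⟨(h t h0 h1).1.trans (le_rayleighLaw_residual hMN m t),
    (rayleighLaw_residual_le hMN m t).trans (h t h0 h1).2⟩⟩

/-! ### Joint law of the users' channels. -/

section Rayleigh

variable {Ω : Type*} [MeasurableSpace Ω] {μ : Measure Ω} {K N M : ℕ}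
  {H : Fin K → Ω → Matrix (Fin N) (Fin M) ℂ}

lemma IsRayleigh.aemeasurable_chan (hH : IsRayleigh μ H) :
    AEMeasurable (fun ω j => chan (H j ω)) μ :=
  aemeasurable_pi_lambda _ fun j => aemeasurable_pi_lambda _ fun m =>
    aemeasurable_pi_lambda _ fun a => (hH.hasLaw j a m).aemeasurable

/-- The joint law of the channels of all users. -/
lemma IsRayleigh.map_chan (hH : IsRayleigh μ H) :
    μ.map (fun ω j => chan (H j ω)) = Measure.pi fun _ : Fin K => rayleighLaw N M := by
  -- Putting the column index before the row index lets two curryings produce, for each user, a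
  -- family of columns.
  let g : Fin K × Fin M × Fin N → Fin K × Fin N × Fin M := fun p => (p.1, p.2.2, p.2.1)
  have hg : Function.Injective g := by
    rintro ⟨j, m, a⟩ ⟨j', m', a'⟩ h
    simp only [g, Prod.mk.injEq] at h ⊢
    tauto
  have hm : ∀ p : Fin K × Fin M × Fin N, AEMeasurable (fun ω => H p.1 ω p.2.2 p.2.1) μ :=
    fun p => (hH.hasLaw _ _ _).aemeasurable
  have h1 : μ.map (fun ω (p : Fin K × Fin M × Fin N) => H p.1 ω p.2.2 p.2.1) =
      Measure.infinitePi fun _ => complexGaussian := by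
    rw [Measure.infinitePi_eq_pi, (hH.indep.precomp hg).map_fun_eq_pi_map hm]
    congr 1
    funext p
    exact (hH.hasLaw _ _ _).map_eq
  have h2 := congrArg (Measure.map (MeasurableEquiv.curry (Fin K) (Fin M × Fin N) ℂ)) h1
  rw [Measure.infinitePi_map_curry (fun _ _ => complexGaussian), Measure.infinitePi_eq_pi,
    AEMeasurable.map_map_of_aemeasurable (MeasurableEquiv.measurable _).aemeasurable
      (aemeasurable_pi_lambda _ hm)] at h2
  have hc : Measurable fun (x : Fin K → Fin M × Fin N → ℂ) j =>
      MeasurableEquiv.curry (Fin M) (Fin N) ℂ (x j) := by fun_prop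
  have h3 := congrArg (Measure.map fun (x : Fin K → Fin M × Fin N → ℂ) j =>
    MeasurableEquiv.curry (Fin M) (Fin N) ℂ (x j)) h2
  rw [AEMeasurable.map_map_of_aemeasurable hc.aemeasurable
      ((MeasurableEquiv.measurable _).comp_aemeasurable (aemeasurable_pi_lambda _ hm)),
    Measure.pi_map_pi fun _ => (MeasurableEquiv.measurable _).aemeasurable,
    Measure.infinitePi_map_curry (fun _ _ => complexGaussian)] at h3
  simp only [Measure.infinitePi_eq_pi] at h3
  exact h3

lemma IsRayleigh.map_chan_apply (hH : IsRayleigh μ H) (j : Fin K) :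
    μ.map (fun ω => chan (H j ω)) = rayleighLaw N M := by
  have h := congrArg (Measure.map (Function.eval j)) hH.map_chan
  rw [AEMeasurable.map_map_of_aemeasurable (measurable_pi_apply j).aemeasurable
    hH.aemeasurable_chan, (measurePreserving_eval _ j).map_eq] at h
  exact h

lemma IsRayleigh.ae_residual_pos (hH : IsRayleigh μ H) (hMN : M ≤ N) :
    ∀ᵐ ω ∂μ, ∀ j m, 0 < residual m (chan (H j ω)) := by
  rw [ae_all_iff]
  intro j
  have h := MIMONOMA.ae_residual_pos hMN
  rw [← hH.map_chan_apply j] at h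
  exact ae_of_ae_map (aemeasurable_pi_iff.1 hH.aemeasurable_chan j) h

lemma IsRayleigh.real_forall_residual_le (hH : IsRayleigh μ H) (m : Fin M) (S : Finset (Fin K))
    (t : ℝ) : μ.real {ω | ∀ j ∈ S, residual m (chan (H j ω)) ≤ t} =
      (rayleighLaw N M).real {B | residual m B ≤ t} ^ S.card := by
  have hS : {x : Fin K → Fin M → Fin N → ℂ | ∀ j ∈ S, residual m (x j) ≤ t} =
      Set.univ.pi fun j => if j ∈ S then {B | residual m B ≤ t} else Set.univ := by
    ext x
    simp only [Set.mem_ofPred_eq, Set.mem_pi, Set.mem_univ, true_implies]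
    refine forall_congr' fun j => ?_
    split_ifs with hj <;> simp [hj]
  have hmS : MeasurableSet {x : Fin K → Fin M → Fin N → ℂ | ∀ j ∈ S, residual m (x j) ≤ t} := by
    rw [hS]
    refine MeasurableSet.univ_pi fun j => ?_
    split_ifs
    exacts [measurableSet_residual_le m t, MeasurableSet.univ]
  have h := Measure.map_apply_of_aemeasurable hH.aemeasurable_chan hmS
  rw [hH.map_chan, hS, Measure.pi_pi] at h
  rw [Measure.real, show {ω | ∀ j ∈ S, residual m (chan (H j ω)) ≤ t} =
    (fun ω j => chan (H j ω)) ⁻¹' Set.univ.pi fun j =>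
      if j ∈ S then {B | residual m B ≤ t} else Set.univ by rw [← hS]; rfl, ← h]
  simp only [apply_ite (rayleighLaw N M), measure_univ, Finset.prod_ite_mem, Finset.univ_inter,
    Finset.prod_const, ENNReal.toReal_pow, Measure.real]

end Rayleigh

/-! ### Zero forcing and maximal ratio combining. -/

section Detection

variable {N M : ℕ} {i : Fin M} {A : Matrix (Fin N) (Fin M) ℂ}
  {U : Matrix (Fin N) (Fin (N - M + 1)) ℂ}

lemma rxGain_eq (m : Fin M) :
    rxGain i A U m = ‖star (mrcWeight i A U) ⬝ᵥ (Uᴴ *ᵥ chan A m)‖ ^ 2 := by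
  rw [rxGain, detector, Matrix.star_mulVec, ← Matrix.dotProduct_mulVec]

/-- With `s = |Uᴴ h|²`, the gain is `(s / √s)² = s`. This survives at `s = 0`, where the inverse is
zero. -/
lemma effGain_eq_normSq : effGain i A U = normSq (Uᴴ *ᵥ chan A i) := by
  rw [effGain, rxGain_eq, mrcWeight, star_smul, smul_dotProduct, ← ofReal_normSq]
  set s := normSq (Uᴴ *ᵥ chan A i) with hs
  have hs0 : 0 ≤ s := normSq_nonneg _
  rw [smul_eq_mul, norm_mul, norm_star, norm_inv, Complex.norm_real, Complex.norm_real,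
    Real.norm_of_nonneg hs0, Real.norm_of_nonneg (Real.sqrt_nonneg s), mul_pow, inv_pow,
    Real.sq_sqrt hs0]
  rcases eq_or_ne s 0 with h | h
  · simp [h]
  · field_simp

lemma rxGain_eq_zero (hU : IsNullBasis i A U) {m : Fin M} (hm : m ≠ i) : rxGain i A U m = 0 := by
  rw [rxGain_eq, hU.2 m hm, dotProduct_zero, norm_zero, zero_pow two_ne_zero]

/-- Positivity is essential: at zero gain the weight, hence the detector, is zero. -/
lemma normSq_detector (hU : IsNullBasis i A U) (h : 0 < effGain i A U) :
    normSq (detector i A U) = 1 := by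
  rw [effGain_eq_normSq] at h
  rw [detector, normSq_mulVec_of_orthonormal hU.1, mrcWeight, normSq_smul, norm_inv,
    Complex.norm_real, Real.norm_of_nonneg (Real.sqrt_nonneg _), inv_pow, Real.sq_sqrt h.le,
    inv_mul_cancel₀ h.ne']

lemma interfNoise_eq (hU : IsNullBasis i A U) (h : 0 < effGain i A U) (ρ : ℝ) :
    interfNoise i A U ρ = 1 / ρ := by
  rw [interfNoise, Finset.sum_eq_zero fun m hm => rxGain_eq_zero hU (Finset.ne_of_mem_erase hm),
    normSq_detector hU h, zero_add, one_mul]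

lemma effGain_eq_residual (hMN : M ≤ N) (hU : IsNullBasis i A U)
    (hA : LinearIndependent ℂ (chan A)) : effGain i A U = residual i (chan A) := by
  rw [effGain_eq_normSq, residual_eq_normSq hMN hA hU.1 hU.2]

end Detection

/-! ### Order statistics of the gains. -/

section Order

variable {K N M : ℕ} {i : Fin M} {A : Fin K → Matrix (Fin N) (Fin M) ℂ}
  {U : Fin K → Matrix (Fin N) (Fin (N - M + 1)) ℂ}

lemma orderedGain_antitone : Antitone (orderedGain i A U) := by
  intro n k hnk
  have := Tuple.monotone_sort (fun j => -effGain i (A j) (U j)) hnk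
  simpa [orderedGain, userOrder] using this

/-- The `k`-th ordered gain is small iff the gains of all but `k` users are. -/
lemma orderedGain_le_iff (k : Fin K) (t : ℝ) : orderedGain i A U k ≤ t ↔
    ∃ S : Finset (Fin K), S.card = K - k ∧ ∀ j ∈ S, effGain i (A j) (U j) ≤ t := by
  constructor
  · intro h
    refine ⟨(Finset.Ici k).map (userOrder i A U).toEmbedding, by simp, fun j hj => ?_⟩
    obtain ⟨l, hl, rfl⟩ := Finset.mem_map.1 hj
    exact (orderedGain_antitone (Finset.mem_Ici.1 hl)).trans h
  · rintro ⟨S, hS, hSt⟩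
    by_contra! h
    -- The `K - k` users of `S` and the `k + 1` strongest ones would be `K + 1` distinct users.
    have hd : Disjoint S ((Finset.Iic k).map (userOrder i A U).toEmbedding) := by
      rw [Finset.disjoint_left]
      intro j hj hj'
      obtain ⟨l, hl, rfl⟩ := Finset.mem_map.1 hj'
      exact (h.trans_le (orderedGain_antitone (Finset.mem_Iic.1 hl))).not_ge (hSt _ hj)
    have := (Finset.card_union_of_disjoint hd).symm.trans_le (Finset.card_le_univ _)
    rw [hS, Finset.card_map, Fin.card_Iic, Fintype.card_fin] at this
    omega

end Order

/-! ### The outage event in terms of the weaker user's gain. -/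

section Outage

lemma threshold_pos {R : ℝ} (hR : 0 < R) : 0 < threshold R :=
  sub_pos.2 (Real.one_lt_rpow one_lt_two hR)

lemma le_logb_one_add {R s : ℝ} (hR : 0 < R) (h : threshold R ≤ s) : R ≤ Real.logb 2 (1 + s) := by
  have := threshold_pos hR
  rw [Real.le_logb_iff_rpow_le one_lt_two (by linarith)]
  rw [threshold] at h
  linarith

lemma weakPower_eq_one {ρ ε x : ℝ} (hε : 0 < ε) (hx : 0 < x) (h : x ≤ ε / ρ) :
    weakPower ρ ε x = 1 := by
  refine min_eq_left ((one_le_div (by positivity)).2 ?_)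
  rw [div_eq_mul_one_div] at h
  linarith

lemma weakPower_of_lt {ρ ε x : ℝ} (hε : 0 < ε) (hx : 0 < x) (h : ε / ρ < x) :
    weakPower ρ ε x = ε * (x + 1 / ρ) / (x * (1 + ε)) := by
  refine min_eq_right ((div_le_one (by positivity)).2 ?_)
  rw [div_eq_mul_one_div] at h
  linarith

variable {K N M : ℕ} {i : Fin M} {A : Fin K → Matrix (Fin N) (Fin M) ℂ}
  {U : Fin K → Matrix (Fin N) (Fin (N - M + 1)) ℂ} {n k : Fin K} {Rn Rk ρ : ℝ}

lemma orderedGain_le_of_strongOutage (hU : ∀ j, IsNullBasis i (A j) (U j)) (hnk : n < k)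
    (hRn : 0 < Rn) (hRk : 0 < Rk) (hρ : 0 < ρ) (h : StrongOutage i A U n k Rn Rk ρ) :
    orderedGain i A U k ≤
      threshold Rk / ρ + (1 + threshold Rk) * threshold Rn / ρ := by
  by_contra! hlt
  have hεk := threshold_pos hRk
  have hεn := threshold_pos hRn
  set εk := threshold Rk with hεk_def
  set εn := threshold Rn with hεn_def
  set x := orderedGain i A U k with hx_def
  have hlt1 : εk / ρ < x := lt_of_le_of_lt (le_add_of_nonneg_right (by positivity)) hlt
  have hx : 0 < x := lt_trans (by positivity) hlt1
  have hy : x ≤ orderedGain i A U n := orderedGain_antitone hnk.le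
  rw [orderedGain] at hy
  simp only [StrongOutage] at h
  rw [← hx_def, ← hεk_def, weakPower_of_lt hεk hx hlt1] at h
  rw [sinrWeakMsg, sinrStrongMsg, interfNoise_eq (hU _) (hx.trans_le hy)] at h
  set y := effGain i (A (userOrder i A U n)) (U (userOrder i A U n))
  have hy0 : 0 < y := hx.trans_le hy
  have has : 1 - εk * (x + 1 / ρ) / (x * (1 + εk)) = (x - εk / ρ) / (x * (1 + εk)) := by
    field_simp
    ring
  rw [has] at h
  have has0 : 0 < (x - εk / ρ) / (x * (1 + εk)) := div_pos (sub_pos.2 hlt1) (by positivity)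
  rcases h with h | h | h
  · exact has0.ne' h
  · refine h.not_ge (le_logb_one_add hRk ?_)
    rw [le_div_iff₀ (by positivity)]
    -- The weaker user, at gain `x`, would meet its target with equality; the surplus at gain `y`
    -- has the sign of `y - x`.
    have key : y * (εk * (x + 1 / ρ) / (x * (1 + εk))) -
        εk * (y * ((x - εk / ρ) / (x * (1 + εk))) + 1 / ρ) = εk * (y - x) / (ρ * x) := by
      field_simp
      ring
    have : 0 ≤ εk * (y - x) / (ρ * x) :=
      div_nonneg (mul_nonneg hεk.le (sub_nonneg.2 hy)) (by positivity)
    linarith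
  · refine h.not_ge (le_logb_one_add hRn ?_)
    rw [le_div_iff₀ (by positivity)]
    -- This is `hlt` rearranged; the right side is the stronger message's share of `x`.
    have h1 : εn * (1 / ρ) ≤ (x - εk / ρ) / (1 + εk) := by
      rw [le_div_iff₀ (by positivity)]
      have : εn * (1 / ρ) * (1 + εk) = (1 + εk) * εn / ρ := by ring
      linarith
    have h2 : (x - εk / ρ) / (1 + εk) = x * ((x - εk / ρ) / (x * (1 + εk))) := by
      field_simp
    rw [h2] at h1
    exact h1.trans (mul_le_mul_of_nonneg_right hy has0.le)

/-- All power goes to the weaker user. Gain zero is excluded because division by zero would make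
`weakPower` equal to `0` there. -/
lemma strongOutage_of_orderedGain_le (hRk : 0 < Rk) (h0 : 0 < orderedGain i A U k)
    (h : orderedGain i A U k ≤ threshold Rk / ρ) : StrongOutage i A U n k Rn Rk ρ :=
  Or.inl (by rw [weakPower_eq_one (threshold_pos hRk) h0 h, sub_self])

end Outage

/-! ### Probability estimates. -/

section Probability

variable {Ω : Type*} [MeasurableSpace Ω] {μ : Measure Ω} {K N M : ℕ}
  {i : Fin M} {H : Fin K → Ω → Matrix (Fin N) (Fin M) ℂ}
  {U : Fin K → Ω → Matrix (Fin N) (Fin (N - M + 1)) ℂ}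

lemma ae_effGain_eq_residual (hMN : M ≤ N) (hH : IsRayleigh μ H)
    (hU : ∀ j ω, IsNullBasis i (H j ω) (U j ω)) :
    ∀ᵐ ω ∂μ, ∀ j, effGain i (H j ω) (U j ω) = residual i (chan (H j ω)) ∧
      0 < effGain i (H j ω) (U j ω) := by
  filter_upwards [hH.ae_residual_pos hMN] with ω hω j
  have h := effGain_eq_residual hMN (hU j ω) (linearIndependent_of_residual_pos (hω j))
  exact ⟨h, h ▸ hω j i⟩

variable [IsProbabilityMeasure μ]

/-- One fixed set of `K - k` users gives the lower bound; a union bound over all such sets gives the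
upper one, with their number in the constant. -/
lemma orderedGainCDF_bounds (hMN : M ≤ N) (hH : IsRayleigh μ H)
    (hU : ∀ j ω, IsNullBasis i (H j ω) (U j ω)) (k : Fin K) :
    ∃ c C : ℝ, 0 < c ∧ 0 < C ∧ ∀ t : ℝ, 0 ≤ t → t ≤ 1 →
      c * t ^ ((N - M + 1) * (K - k)) ≤ orderedGainCDF μ i H U k t ∧
        orderedGainCDF μ i H U k t ≤ C * t ^ ((N - M + 1) * (K - k)) := by
  obtain ⟨c, C, hc, hC, h⟩ := rayleighLaw_residual_bounds (N := N) hMN i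
  have hae := ae_effGain_eq_residual hMN hH hU
  let 𝒮 := Finset.powersetCard (K - k) (Finset.univ : Finset (Fin K))
  have hcard : (Finset.Ici k).card = K - k := Fin.card_Ici k
  have h𝒮 : 0 < 𝒮.card := Finset.card_pos.2
    ⟨_, Finset.mem_powersetCard.2 ⟨Finset.subset_univ _, hcard⟩⟩
  refine ⟨c ^ (K - k : ℕ), 𝒮.card * C ^ (K - k : ℕ), by positivity, by positivity,
    fun t h0 h1 => ⟨?_, ?_⟩⟩
  · rw [pow_mul, ← mul_pow]
    refine (pow_le_pow_left₀ (by positivity) (h t h0 h1).1 _).trans ?_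
    rw [← hcard, ← hH.real_forall_residual_le]
    refine ENNReal.toReal_mono (measure_ne_top _ _) (measure_mono_ae ?_)
    filter_upwards [hae] with ω hω hS
    exact (orderedGain_le_iff k t).2 ⟨_, hcard, fun j hj => (hω j).1.trans_le (hS j hj)⟩
  · calc orderedGainCDF μ i H U k t
        ≤ μ.real (⋃ S ∈ 𝒮, {ω | ∀ j ∈ S, residual i (chan (H j ω)) ≤ t}) := by
          refine ENNReal.toReal_mono (measure_ne_top _ _) (measure_mono_ae ?_)
          filter_upwards [hae] with ω hω ht
          obtain ⟨S, hS, hSt⟩ := (orderedGain_le_iff k t).1 ht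
          exact Set.mem_biUnion (Finset.mem_powersetCard.2 ⟨Finset.subset_univ _, hS⟩)
            fun j hj => (hω j).1.symm.trans_le (hSt j hj)
      _ ≤ ∑ S ∈ 𝒮, μ.real {ω | ∀ j ∈ S, residual i (chan (H j ω)) ≤ t} :=
          measureReal_biUnion_finset_le _ _
      _ ≤ ∑ S ∈ 𝒮, (C * t ^ (N - M + 1)) ^ (K - k : ℕ) := by
          refine Finset.sum_le_sum fun S hS => ?_
          rw [hH.real_forall_residual_le, (Finset.mem_powersetCard.1 hS).2]
          exact pow_le_pow_left₀ measureReal_nonneg (h t h0 h1).2 _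
      _ = _ := by
          rw [Finset.sum_const, nsmul_eq_mul, mul_pow, ← pow_mul, mul_assoc]

variable {n k : Fin K} {Rn Rk ρ : ℝ}

/-- The events are nested at every `ω`. They need not be measurable: monotonicity of the outer
measure suffices. -/
lemma outageProb_le_orderedGainCDF (hU : ∀ j ω, IsNullBasis i (H j ω) (U j ω)) (hnk : n < k)
    (hRn : 0 < Rn) (hRk : 0 < Rk) (hρ : 0 < ρ) : outageProb μ i H U n k Rn Rk ρ ≤
      orderedGainCDF μ i H U k (threshold Rk / ρ + (1 + threshold Rk) * threshold Rn / ρ) :=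
  measureReal_mono fun ω hω =>
    orderedGain_le_of_strongOutage (fun j => hU j ω) hnk hRn hRk hρ hω

lemma orderedGainCDF_le_outageProb (hMN : M ≤ N) (hH : IsRayleigh μ H)
    (hU : ∀ j ω, IsNullBasis i (H j ω) (U j ω)) (hRk : 0 < Rk) :
    orderedGainCDF μ i H U k (threshold Rk / ρ) ≤ outageProb μ i H U n k Rn Rk ρ := by
  refine ENNReal.toReal_mono (measure_ne_top _ _) (measure_mono_ae ?_)
  filter_upwards [ae_effGain_eq_residual hMN hH hU] with ω hω ht
  exact strongOutage_of_orderedGain_le hRk (hω _).2 ht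

lemma eventually_outageProb_bounds (hMN : M ≤ N) (hH : IsRayleigh μ H)
    (hU : ∀ j ω, IsNullBasis i (H j ω) (U j ω)) (hnk : n < k) (hRn : 0 < Rn) (hRk : 0 < Rk) :
    ∃ c C : ℝ, 0 < c ∧ 0 < C ∧ ∀ᶠ ρ : ℝ in atTop,
      c * (1 / ρ ^ ((N - M + 1) * (K - k))) ≤ outageProb μ i H U n k Rn Rk ρ ∧
        outageProb μ i H U n k Rn Rk ρ ≤ C * (1 / ρ ^ ((N - M + 1) * (K - k))) := by
  obtain ⟨c, C, hc, hC, h⟩ := orderedGainCDF_bounds hMN hH hU k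
  have hεk := threshold_pos hRk
  have hεn := threshold_pos hRn
  set a := threshold Rk
  set b := threshold Rk + (1 + threshold Rk) * threshold Rn with hb
  have hb0 : 0 < b := by positivity
  refine ⟨c * a ^ ((N - M + 1) * (K - k)), C * b ^ ((N - M + 1) * (K - k)), by positivity,
    by positivity, ?_⟩
  -- These bring `a / ρ` and `b / ρ` into `[0, 1]`, where the small-ball bounds hold.
  filter_upwards [eventually_gt_atTop 0, eventually_ge_atTop a, eventually_ge_atTop b]
    with ρ hρ hρa hρb
  have ha := (h (a / ρ) (by positivity) (div_le_one_of_le₀ hρa hρ.le)).1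
  have hb' := (h (b / ρ) (by positivity) (div_le_one_of_le₀ hρb hρ.le)).2
  rw [div_pow] at ha hb'
  refine ⟨?_, ?_⟩
  · rw [mul_assoc, mul_one_div]
    exact ha.trans (orderedGainCDF_le_outageProb hMN hH hU hRk)
  · rw [mul_assoc, mul_one_div]
    refine (outageProb_le_orderedGainCDF hU hnk hRn hRk hρ).trans ?_
    rwa [← add_div]

end Probability

/-! ### From two-sided bounds to asymptotics. -/

lemma HasDiversityOrder.of_eventually_bounds {P : ℝ → ℝ} {D : ℕ} {c C : ℝ} (hc : 0 < c)
    (hC : 0 < C) (h : ∀ᶠ ρ : ℝ in atTop, c * (1 / ρ ^ D) ≤ P ρ ∧ P ρ ≤ C * (1 / ρ ^ D)) :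
    HasDiversityOrder P D := by
  have hlim : ∀ a : ℝ, Tendsto (fun ρ : ℝ => D - Real.log a / Real.log ρ) atTop (𝓝 D) := by
    intro a
    simpa using tendsto_const_nhds.sub (Real.tendsto_log_atTop.const_div_atTop (Real.log a))
  have hlog : ∀ a ρ : ℝ, 0 < a → 1 < ρ →
      D - Real.log a / Real.log ρ = -Real.log (a * (1 / ρ ^ D)) / Real.log ρ := by
    intro a ρ ha hρ
    have := Real.log_pos hρ
    rw [Real.log_mul ha.ne' (by positivity), one_div, Real.log_inv, Real.log_pow]
    field_simp
    ring
  -- The constants swap roles because `-log` reverses order.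
  refine tendsto_of_tendsto_of_tendsto_of_le_of_le' (hlim C) (hlim c) ?_ ?_
  · filter_upwards [h, eventually_gt_atTop 1] with ρ hρ h1
    have hpos : 0 < c * (1 / ρ ^ D) := by positivity
    rw [hlog C ρ hC h1]
    exact div_le_div_of_nonneg_right
      (neg_le_neg (Real.log_le_log (hpos.trans_le hρ.1) hρ.2)) (Real.log_pos h1).le
  · filter_upwards [h, eventually_gt_atTop 1] with ρ hρ h1
    have hpos : 0 < c * (1 / ρ ^ D) := by positivity
    rw [hlog c ρ hc h1]
    exact div_le_div_of_nonneg_right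
      (neg_le_neg (Real.log_le_log hpos hρ.1)) (Real.log_pos h1).le

lemma isTheta_of_eventually_bounds {P g : ℝ → ℝ} {c C : ℝ} (hc : 0 < c)
    (h : ∀ᶠ ρ : ℝ in atTop, 0 ≤ g ρ ∧ c * g ρ ≤ P ρ ∧ P ρ ≤ C * g ρ) : P =Θ[atTop] g := by
  constructor
  · refine IsBigO.of_bound C (h.mono fun ρ hρ => ?_)
    rw [Real.norm_of_nonneg hρ.1,
      Real.norm_of_nonneg ((mul_nonneg hc.le hρ.1).trans hρ.2.1)]
    exact hρ.2.2
  · refine IsBigO.of_bound c⁻¹ (h.mono fun ρ hρ => ?_)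
    rw [Real.norm_of_nonneg hρ.1,
      Real.norm_of_nonneg ((mul_nonneg hc.le hρ.1).trans hρ.2.1), le_inv_mul_iff₀ hc]
    exact hρ.2.1

end MIMONOMA

theorem lemma3 {Ω : Type*} [MeasurableSpace Ω] (μ : Measure Ω) [IsProbabilityMeasure μ]
    {K N M : ℕ} (hMN : M ≤ N) (i : Fin M)
    (H : Fin K → Ω → Matrix (Fin N) (Fin M) ℂ) (hH : MIMONOMA.IsRayleigh μ H)
    (U : Fin K → Ω → Matrix (Fin N) (Fin (N - M + 1)) ℂ)
    (hU : ∀ j ω, MIMONOMA.IsNullBasis i (H j ω) (U j ω))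
    (n k : Fin K) (hnk : n < k) (Rn Rk : ℝ) (hRn : 0 < Rn) (hRk : 0 < Rk) :
    (∀ ρ : ℝ, 0 < ρ →
      MIMONOMA.outageProb μ i H U n k Rn Rk ρ ≤
        MIMONOMA.orderedGainCDF μ i H U k
          (MIMONOMA.threshold Rk / ρ +
            (1 + MIMONOMA.threshold Rk) * MIMONOMA.threshold Rn / ρ)) ∧
    (fun ρ : ℝ => MIMONOMA.outageProb μ i H U n k Rn Rk ρ) =Θ[atTop]
      (fun ρ : ℝ => 1 / ρ ^ ((N - M + 1) * (K - (k.val + 1) + 1))) ∧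
    MIMONOMA.HasDiversityOrder (fun ρ : ℝ => MIMONOMA.outageProb μ i H U n k Rn Rk ρ)
      (((N - M + 1) * (K - (k.val + 1) + 1) : ℕ) : ℝ) := by
  -- The one-based rank is `k.val + 1`; subtraction is not truncated since `k < K`.
  have hk : K - (k.val + 1) + 1 = K - k := by omega
  rw [hk]
  obtain ⟨c, C, hc, hC, h⟩ := MIMONOMA.eventually_outageProb_bounds hMN hH hU hnk hRn hRk
  refine ⟨fun ρ hρ => MIMONOMA.outageProb_le_orderedGainCDF hU hnk hRn hRk hρ, ?_,
    .of_eventually_bounds hc hC h⟩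
  refine MIMONOMA.isTheta_of_eventually_bounds hc (C := C) ?_
  filter_upwards [h, eventually_gt_atTop 0] with ρ hρ h0
  exact ⟨by positivity, hρ⟩
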